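/- Let $p>3$ be a prime. Let $\Gamma_p:\mathbb{Z}_p\to\mathbb{Z}_p$ denote Morita's $p$-adic Gamma function, that is, the unique continuous function on $\mathbb{Z}_p$ with $$\Gamma_p(n)=(-1)^n\prod_{\substack{0\le k<n\\ \gcd(k,p)=1}}k\qquad\text{for all integers } n>1,$$ let $H_k=\sum_{j=1}^{k}\frac1j$ be the $k$-th harmonic number (with $H_0=0$), and let $q_p(2)=\frac{2^{p-1}-1}{p}$ be the Fermat quotient. Then $$\sum_{k=0}^{p-1}\binom{2k}{k}^2\frac{H_k}{32^k}\equiv \begin{cases} \Gamma_p\left(\frac12\right)\Gamma_p\left(\frac14\right)^2\left(2q_p(2)-p\,q_p(2)^2\right) & \text{if } p\equiv 1\pmod 4,\\[2mm] \frac12\,\Gamma_p\left(\frac12\right)\Gamma_p\left(\frac14\right)^2 & \text{if } p\equiv 3\pmod 4, \end{cases} \pmod{p^2},$$ where the congruence is in $\mathbb{Z}_p$, i.e. the difference of the two sides lies in $p^2\mathbb{Z}_p$. -/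

import Mathlib

open Filter Topology

/-- The sequence `n ↦ (-1)^n ∏_{0 ≤ k < n, (k,p)=1} k` that Morita's `p`-adic Gamma function
interpolates. -/
def moritaSeq (p n : ℕ) : ℤ :=
  (-1) ^ n * ∏ k ∈ (Finset.range n).filter (fun k => Nat.Coprime k p), (k : ℤ)

/-- Morita's `p`-adic Gamma function `Γ_p : ℤ_p → ℤ_p`, as the limit of `moritaSeq p n` as `n` runs
over natural numbers tending `p`-adically to `x`. For odd `p` it is the unique continuous
function on `ℤ_p` with `Γ_p(n) = moritaSeq p n` for all natural numbers `n > 1`: see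
`padicGamma_natCast`, `continuous_padicGamma`, `eq_padicGamma`. -/
noncomputable def padicGamma (p : ℕ) [Fact p.Prime] (x : ℤ_[p]) : ℤ_[p] :=
  limUnder (comap (Nat.cast : ℕ → ℤ_[p]) (𝓝 x)) (fun n => ((moritaSeq p n : ℤ) : ℤ_[p]))

/-- The Fermat quotient `q_p(a) = (a^(p-1) - 1) / p`, as a rational number. -/
def fermatQuotient (p : ℕ) (a : ℤ) : ℚ := ((a : ℚ) ^ (p - 1) - 1) / p

/-- Congruence modulo `p^n` of `p`-adic numbers: the difference lies in `p^n ℤ_p`. -/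
def PadicModEq (p : ℕ) [Fact p.Prime] (n : ℕ) (a b : ℚ_[p]) : Prop :=
  ∃ z : ℤ_[p], a - b = (p : ℚ_[p]) ^ n * (z : ℚ_[p])

theorem units_sq_eq_one_aux (p : ℕ) [Fact p.Prime] (hp : p ≠ 2) (N : ℕ)
    (u : (ZMod (p ^ N))ˣ) (h : u * u = 1) : u = 1 ∨ u = -1 := by
  have hpp : p.Prime := Fact.out
  obtain ⟨a, ha⟩ := ZMod.intCast_surjective (u : ZMod (p ^ N))
  have h1 : ((((a - 1) * (a + 1) : ℤ)) : ZMod (p ^ N)) = 0 := by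
    have h2 : (u : ZMod (p ^ N)) * u = 1 := by
      rw [← Units.val_mul, h, Units.val_one]
    push_cast
    rw [ha]
    linear_combination h2
  rw [ZMod.intCast_zmod_eq_zero_iff_dvd] at h1
  push_cast at h1
  by_cases hd : (p : ℤ) ∣ a - 1
  · left
    have hnd : ¬ (p : ℤ) ∣ a + 1 := by
      intro hd2
      have h3 : (p : ℤ) ∣ 2 := by
        have := dvd_sub hd2 hd
        ring_nf at this
        exact this
      have h4 : p ∣ 2 := by exact_mod_cast h3
      exact hp ((Nat.prime_dvd_prime_iff_eq hpp Nat.prime_two).1 h4)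
    have hc : IsCoprime ((p : ℤ) ^ N) (a + 1) :=
      IsCoprime.pow_left ((Prime.coprime_iff_not_dvd (Nat.prime_iff_prime_int.1 hpp)).2 hnd)
    have h5 := hc.dvd_of_dvd_mul_right h1
    have h6 : ((a - 1 : ℤ) : ZMod (p ^ N)) = 0 := by
      rw [ZMod.intCast_zmod_eq_zero_iff_dvd]; exact_mod_cast h5
    push_cast at h6
    ext
    rw [← ha, Units.val_one]
    exact sub_eq_zero.1 h6
  · right
    have hc : IsCoprime ((p : ℤ) ^ N) (a - 1) :=
      IsCoprime.pow_left ((Prime.coprime_iff_not_dvd (Nat.prime_iff_prime_int.1 hpp)).2 hd)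
    have h5 := hc.dvd_of_dvd_mul_left h1
    have h6 : ((a + 1 : ℤ) : ZMod (p ^ N)) = 0 := by
      rw [ZMod.intCast_zmod_eq_zero_iff_dvd]; exact_mod_cast h5
    push_cast at h6
    ext
    rw [← ha, Units.val_neg, Units.val_one]
    exact eq_neg_of_add_eq_zero_left h6

theorem prod_units_aux (p : ℕ) [Fact p.Prime] (hp : p ≠ 2) (N : ℕ) :
    ∏ u : (ZMod (p ^ N))ˣ, u = -1 := by
  classical
  have key : ∏ u ∈ Finset.univ.erase (-1 : (ZMod (p ^ N))ˣ), u = 1 :=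
    Finset.prod_involution (fun u _ => u⁻¹) (by simp)
      (fun u hu hne heq => by
        have h2 : u * u = 1 := by
          nth_rewrite 1 [← heq]
          exact inv_mul_cancel u
        rcases units_sq_eq_one_aux p hp N u h2 with h | h
        · exact hne h
        · exact (Finset.mem_erase.1 hu).1 h)
      (fun u hu => by simpa [inv_eq_iff_eq_inv] using hu)
      (fun u _ => inv_inv u)
  rw [← Finset.mul_prod_erase _ _ (Finset.mem_univ (-1 : (ZMod (p ^ N))ˣ)), key, mul_one]

theorem moritaSeq_cast_aux (p N : ℕ) (hN : N ≠ 0) (n : ℕ) (g : ZMod (p ^ N) → ZMod (p ^ N))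
    (hg : ∀ x, IsUnit x → g x = x) (hg' : ∀ x, ¬ IsUnit x → g x = 1) :
    ((moritaSeq p n : ℤ) : ZMod (p ^ N)) =
      (-1) ^ n * ∏ k ∈ Finset.range n, g ((k : ℕ) : ZMod (p ^ N)) := by
  unfold moritaSeq
  push_cast
  rw [Finset.prod_filter]
  congr 1
  refine Finset.prod_congr rfl fun k _ => ?_
  have hk : IsUnit ((k : ℕ) : ZMod (p ^ N)) ↔ Nat.Coprime k p := by
    rw [ZMod.isUnit_iff_coprime, Nat.coprime_pow_right_iff (Nat.pos_of_ne_zero hN)]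
  by_cases h : Nat.Coprime k p
  · rw [if_pos h, hg _ (hk.2 h)]
  · rw [if_neg h, hg' _ (fun h' => h (hk.1 h'))]

theorem moritaSeq_add_aux (p : ℕ) [Fact p.Prime] (hp : p ≠ 2) (N : ℕ) (hN : N ≠ 0) (n : ℕ) :
    ((moritaSeq p (n + p ^ N) : ℤ) : ZMod (p ^ N)) = ((moritaSeq p n : ℤ) : ZMod (p ^ N)) := by
  classical
  have hpp : p.Prime := Fact.out
  set g : ZMod (p ^ N) → ZMod (p ^ N) := fun x => if IsUnit x then x else 1 with hg
  have hg1 : ∀ x, IsUnit x → g x = x := fun x hx => by simp [hg, hx]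
  have hg2 : ∀ x, ¬ IsUnit x → g x = 1 := fun x hx => by simp [hg, hx]
  rw [moritaSeq_cast_aux p N hN _ g hg1 hg2, moritaSeq_cast_aux p N hN _ g hg1 hg2,
    Finset.prod_range_add, pow_add, ((hpp.odd_of_ne_two hp).pow (n := N)).neg_one_pow]
  have h1 : ∏ i ∈ Finset.range (p ^ N), g (((n + i : ℕ)) : ZMod (p ^ N)) =
      ∏ x : ZMod (p ^ N), g (n + x) := by
    refine Finset.prod_bij (fun i _ => ((i : ℕ) : ZMod (p ^ N))) (fun _ _ => Finset.mem_univ _)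
      ?_ ?_ ?_
    · intro a ha b hb hab
      rw [ZMod.natCast_eq_natCast_iff'] at hab
      rwa [Nat.mod_eq_of_lt (Finset.mem_range.1 ha), Nat.mod_eq_of_lt (Finset.mem_range.1 hb)]
        at hab
    · intro x _
      exact ⟨x.val, Finset.mem_range.2 (ZMod.val_lt x), ZMod.natCast_zmod_val x⟩
    · intro i _
      simp [hg]
  have h2 : ∏ x : ZMod (p ^ N), g (n + x) = ∏ x : ZMod (p ^ N), g x :=
    Fintype.prod_equiv (Equiv.addLeft (n : ZMod (p ^ N))) _ _ (fun _ => rfl)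
  have h3 : ∏ x : ZMod (p ^ N), g x = -1 := by
    have h4 : ∏ u : (ZMod (p ^ N))ˣ, (u : ZMod (p ^ N)) = -1 := by
      rw [← Units.coe_prod, prod_units_aux p hp N, Units.val_neg, Units.val_one]
    rw [← h4, hg, ← Finset.prod_filter]
    symm
    refine Finset.prod_bij (fun u _ => (u : ZMod (p ^ N))) ?_ ?_ ?_ ?_
    · intro u _
      simp
    · intro a _ b _ hab
      exact Units.ext hab
    · intro x hx
      obtain ⟨u, rfl⟩ := (Finset.mem_filter.1 hx).2
      exact ⟨u, Finset.mem_univ _, rfl⟩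
    · intro _ _
      rfl
  rw [h1, h2, h3]
  ring

theorem moritaSeq_congr_aux (p : ℕ) [Fact p.Prime] (hp : p ≠ 2) (N : ℕ) (hN : N ≠ 0) (m n : ℕ)
    (h : (m : ZMod (p ^ N)) = n) :
    ((moritaSeq p m : ℤ) : ZMod (p ^ N)) = ((moritaSeq p n : ℤ) : ZMod (p ^ N)) := by
  have hmul : ∀ a t : ℕ, ((moritaSeq p (a + t * p ^ N) : ℤ) : ZMod (p ^ N)) =
      ((moritaSeq p a : ℤ) : ZMod (p ^ N)) := by
    intro a t
    induction t with
    | zero => simp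
    | succ t ih => rw [Nat.succ_mul, ← add_assoc, moritaSeq_add_aux p hp N hN, ih]
  rw [ZMod.natCast_eq_natCast_iff'] at h
  have hm := hmul (m % p ^ N) (m / p ^ N)
  have hn := hmul (n % p ^ N) (n / p ^ N)
  rw [Nat.mod_add_div'] at hm hn
  rw [hm, hn, h]

theorem toZModPow_eq_iff_aux (p : ℕ) [Fact p.Prime] (N : ℕ) (x y : ℤ_[p]) :
    PadicInt.toZModPow N x = PadicInt.toZModPow N y ↔ ‖x - y‖ ≤ (p : ℝ) ^ (-N : ℤ) := by
  rw [PadicInt.norm_le_pow_iff_mem_span_pow, ← PadicInt.ker_toZModPow, RingHom.mem_ker, map_sub,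
    sub_eq_zero]

theorem comap_natCast_neBot_aux (p : ℕ) [Fact p.Prime] (x : ℤ_[p]) :
    (comap (Nat.cast : ℕ → ℤ_[p]) (𝓝 x)).NeBot := by
  rw [comap_neBot_iff]
  intro t ht
  obtain ⟨_, h1, n, rfl⟩ := mem_closure_iff_nhds.1 (PadicInt.denseRange_natCast x) t ht
  exact ⟨n, h1⟩

theorem exists_tendsto_moritaSeq (p : ℕ) [Fact p.Prime] (hp : p ≠ 2) (x : ℤ_[p]) :
    ∃ y : ℤ_[p], Tendsto (fun n => ((moritaSeq p n : ℤ) : ℤ_[p]))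
      (comap (Nat.cast : ℕ → ℤ_[p]) (𝓝 x)) (𝓝 y) := by
  have : (comap (Nat.cast : ℕ → ℤ_[p]) (𝓝 x)).NeBot :=
    comap_natCast_neBot_aux p x
  refine cauchy_map_iff_exists_tendsto.1 ?_
  rw [Metric.cauchy_iff]
  refine ⟨inferInstance, fun ε hε => ?_⟩
  obtain ⟨N, hN⟩ := PadicInt.exists_pow_neg_lt p hε
  have hp1 : (1 : ℝ) < p := by exact_mod_cast (Fact.out : p.Prime).one_lt
  have hN' : (p : ℝ) ^ (-((N + 1 : ℕ)) : ℤ) < ε := by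
    refine lt_of_le_of_lt (zpow_le_zpow_right₀ hp1.le ?_) hN
    push_cast; linarith
  have hpos : (0 : ℝ) < (p : ℝ) ^ (-((N + 1 : ℕ)) : ℤ) := zpow_pos (by linarith) _
  refine ⟨_, image_mem_map (preimage_mem_comap (Metric.ball_mem_nhds x hpos)), ?_⟩
  rintro _ ⟨m, hm, rfl⟩ _ ⟨n, hn, rfl⟩
  rw [dist_eq_norm]
  refine lt_of_le_of_lt ((toZModPow_eq_iff_aux p (N + 1) _ _).1 ?_) hN'
  have hm' := (toZModPow_eq_iff_aux p (N + 1) (m : ℤ_[p]) x).2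
    (by rw [← dist_eq_norm]; exact (Metric.mem_ball.1 hm).le)
  have hn' := (toZModPow_eq_iff_aux p (N + 1) (n : ℤ_[p]) x).2
    (by rw [← dist_eq_norm]; exact (Metric.mem_ball.1 hn).le)
  have hmn := hm'.trans hn'.symm
  rw [map_natCast, map_natCast] at hmn
  simp only [map_intCast]
  exact moritaSeq_congr_aux p hp (N + 1) (Nat.succ_ne_zero N) m n hmn

theorem tendsto_padicGamma (p : ℕ) [Fact p.Prime] (hp : p ≠ 2) (x : ℤ_[p]) :
    Tendsto (fun n => ((moritaSeq p n : ℤ) : ℤ_[p]))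
      (comap (Nat.cast : ℕ → ℤ_[p]) (𝓝 x)) (𝓝 (padicGamma p x)) :=
  tendsto_nhds_limUnder (exists_tendsto_moritaSeq p hp x)

/-- `Γ_p` extends the sequence. -/
theorem padicGamma_natCast (p : ℕ) [Fact p.Prime] (hp : p ≠ 2) (n : ℕ) :
    padicGamma p (n : ℤ_[p]) = ((moritaSeq p n : ℤ) : ℤ_[p]) := by
  have h : pure n ≤ comap (Nat.cast : ℕ → ℤ_[p]) (𝓝 (n : ℤ_[p])) := by
    rw [← map_le_iff_le_comap, map_pure]
    exact pure_le_nhds _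
  exact tendsto_nhds_unique ((tendsto_padicGamma p hp n).mono_left h)
    (tendsto_pure_nhds _ n)

theorem toZModPow_padicGamma_aux (p : ℕ) [Fact p.Prime] (hp : p ≠ 2) (N : ℕ) (hN : N ≠ 0)
    (x : ℤ_[p]) (n : ℕ) (h : PadicInt.toZModPow N x = n) :
    PadicInt.toZModPow N (padicGamma p x) = ((moritaSeq p n : ℤ) : ZMod (p ^ N)) := by
  have : (comap (Nat.cast : ℕ → ℤ_[p]) (𝓝 x)).NeBot :=
    comap_natCast_neBot_aux p x
  have hp1 : (1 : ℝ) < p := by exact_mod_cast (Fact.out : p.Prime).one_lt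
  have hpos : (0 : ℝ) < (p : ℝ) ^ (-N : ℤ) := zpow_pos (by linarith) _
  have e1 := (tendsto_padicGamma p hp x).eventually (Metric.ball_mem_nhds _ hpos)
  have e2 : ∀ᶠ m : ℕ in comap (Nat.cast : ℕ → ℤ_[p]) (𝓝 x),
      (m : ℤ_[p]) ∈ Metric.ball x ((p : ℝ) ^ (-N : ℤ)) :=
    preimage_mem_comap (Metric.ball_mem_nhds x hpos)
  obtain ⟨m, h1, h2⟩ := (e1.and e2).exists
  have h1' := (toZModPow_eq_iff_aux p N _ (padicGamma p x)).2
    (by rw [← dist_eq_norm]; exact (Metric.mem_ball.1 h1).le)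
  have h2' := (toZModPow_eq_iff_aux p N (m : ℤ_[p]) x).2
    (by rw [← dist_eq_norm]; exact (Metric.mem_ball.1 h2).le)
  rw [map_natCast, h] at h2'
  rw [← h1', map_intCast]
  exact moritaSeq_congr_aux p hp N hN m n h2'

/-- `Γ_p` is continuous on `ℤ_p`. -/
theorem continuous_padicGamma (p : ℕ) [Fact p.Prime] (hp : p ≠ 2) :
    Continuous (padicGamma p) := by
  rw [Metric.continuous_iff]
  intro x ε hε
  obtain ⟨N, hN⟩ := PadicInt.exists_pow_neg_lt p hε
  have hp1 : (1 : ℝ) < p := by exact_mod_cast (Fact.out : p.Prime).one_lt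
  have hN' : (p : ℝ) ^ (-((N + 1 : ℕ)) : ℤ) < ε := by
    refine lt_of_le_of_lt (zpow_le_zpow_right₀ hp1.le ?_) hN
    push_cast; linarith
  refine ⟨(p : ℝ) ^ (-((N + 1 : ℕ)) : ℤ), zpow_pos (by linarith) _, fun y hy => ?_⟩
  rw [dist_eq_norm] at hy ⊢
  refine lt_of_le_of_lt ((toZModPow_eq_iff_aux p (N + 1) _ _).1 ?_) hN'
  have h1 := (toZModPow_eq_iff_aux p (N + 1) y x).2 hy.le
  have h2 : PadicInt.toZModPow (N + 1) x =
      (((PadicInt.toZModPow (N + 1) x).val : ℕ) : ZMod (p ^ (N + 1))) :=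
    (ZMod.natCast_zmod_val _).symm
  rw [toZModPow_padicGamma_aux p hp (N + 1) (Nat.succ_ne_zero N) x _ h2,
    toZModPow_padicGamma_aux p hp (N + 1) (Nat.succ_ne_zero N) y _ (h1.trans h2)]

/-- `Γ_p` is the only continuous function on `ℤ_p` that extends the sequence from the natural
numbers `n > 1`. -/
theorem eq_padicGamma (p : ℕ) [Fact p.Prime] (hp : p ≠ 2) (f : ℤ_[p] → ℤ_[p])
    (hf : Continuous f) (h : ∀ n : ℕ, 1 < n → f n = ((moritaSeq p n : ℤ) : ℤ_[p])) :
    f = padicGamma p := by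
  have hppos : 0 < p := (Fact.out : p.Prime).pos
  have hlim : ∀ n : ℕ, Tendsto (fun k : ℕ => ((n : ℤ_[p]) + (p : ℤ_[p]) ^ k)) atTop
      (𝓝 (n : ℤ_[p])) := by
    intro n
    have h0 : Tendsto (fun k : ℕ => (p : ℤ_[p]) ^ k) atTop (𝓝 0) :=
      tendsto_pow_atTop_nhds_zero_of_norm_lt_one (PadicInt.norm_lt_one_iff_dvd _ |>.2 dvd_rfl)
    simpa using h0.const_add (n : ℤ_[p])
  have hg := continuous_padicGamma p hp
  refine PadicInt.denseRange_natCast.equalizer hf hg (funext fun n => ?_)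
  refine tendsto_nhds_unique ((hf.tendsto _).comp (hlim n))
    (((hg.tendsto _).comp (hlim n)).congr' ?_)
  filter_upwards [eventually_ge_atTop 1] with k hk
  have h1 : 1 < n + p ^ k :=
    lt_of_lt_of_le (Nat.one_lt_pow (by omega) (Fact.out : p.Prime).one_lt) (Nat.le_add_left _ _)
  have h2 := h (n + p ^ k) h1
  have h3 := padicGamma_natCast p hp (n + p ^ k)
  push_cast at h2 h3
  simp only [Function.comp]
  rw [h2, h3]

/-- For a prime `p > 3`, `PadicInt.inv 2` and `PadicInt.inv 4` are the genuine `1/2`, `1/4`. -/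
theorem inv_two_four (p : ℕ) [Fact p.Prime] (hp : 3 < p) :
    (2 : ℤ_[p]) * PadicInt.inv 2 = 1 ∧ (4 : ℤ_[p]) * PadicInt.inv 4 = 1 := by
  have hpp : p.Prime := Fact.out
  have h2 : Nat.Coprime p 2 := (Nat.coprime_primes hpp Nat.prime_two).2 (by omega)
  have n2 : ‖((2 : ℕ) : ℤ_[p])‖ = 1 := PadicInt.norm_natCast_eq_one_iff.2 h2
  have n4 : ‖((4 : ℕ) : ℤ_[p])‖ = 1 := PadicInt.norm_natCast_eq_one_iff.2 (h2.pow_right 2)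
  exact ⟨PadicInt.mul_inv (by exact_mod_cast n2), PadicInt.mul_inv (by exact_mod_cast n4)⟩

/-!
Write `p = 2 n + 1`. Since `(2 j + 1) ^ 2 - p ^ 2 = 4 (j - n) (j + n + 1)`, one has
`C(2k, k) ^ 2 ≡ C(n, k) C(n + k, k) (-16) ^ k` modulo `p ^ 2`, which turns the sum into
`∑ k, C(n, k) C(n + k, k) (-1/2) ^ k H_k`. Without the factor `H_k` this is the value at `0` of the
Legendre polynomial of degree `n`, and the three-term recurrence gives closed forms for both sums.

The closed forms become values of `Γ_p` because `Γ_p(x + t) Γ_p(x - t) ≡ Γ_p(x) ^ 2` modulo `t ^ 2`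
whenever `p ∣ t`: by the functional equation the property passes from `x` to `x + 1`, and at `x = 0`
both sides are `1`. It is applied with `x = 1/4` and `t = p/4`, where `x + t` and `x - t` differ
from `0` or `1/2` by integers.

For `p ≡ 1` modulo `4` a factor `H_n` remains. Comparing both sides of
`4 ^ n ∏ (1 - p / (2 j)) = ∏ (1 - p / j)`, with `j` from `1` to `n`, modulo `p ^ 3` yields
`H_n ≡ -2 q + p q ^ 2` modulo `p ^ 2`, where `q` is the Fermat quotient of `2`.
-/

/-- Up to the sign `(-1) ^ k`, the coefficient of `X ^ k` in the shifted Legendre polynomial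
`Polynomial.shiftedLegendre n`. -/
def legendreCoeff (n k : ℕ) : ℕ := n.choose k * (n + k).choose k

namespace legendreCoeff

theorem zero_right (n : ℕ) : legendreCoeff n 0 = 1 := by simp [legendreCoeff]

theorem eq_zero_of_lt {n k : ℕ} (h : n < k) : legendreCoeff n k = 0 := by
  simp [legendreCoeff, Nat.choose_eq_zero_of_lt h]

theorem succ_left {R : Type*} [CommRing R] (n k : ℕ) :
    ((n : R) + 1 - k) * legendreCoeff (n + 1) k = (n + 1 + k) * legendreCoeff n k := by
  rcases le_or_gt k (n + 1) with hk | hk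
  · have h₁ := congrArg (Nat.cast : ℕ → R) (Nat.choose_mul_succ_eq n k)
    have h₂ := congrArg (Nat.cast : ℕ → R) (Nat.choose_mul_succ_eq (n + k) k)
    rw [show n + k + 1 - k = n + 1 by lia, show n + k + 1 = n + 1 + k by lia] at h₂
    push_cast [legendreCoeff, Nat.cast_sub hk] at h₁ h₂ ⊢
    linear_combination -((n + 1 + k).choose k : R) * h₁ - (n.choose k : R) * h₂
  · simp [eq_zero_of_lt hk, eq_zero_of_lt (show n < k by lia)]

theorem succ_right {R : Type*} [CommRing R] (n k : ℕ) :
    ((k : R) + 1) ^ 2 * legendreCoeff n (k + 1) = (n - k) * (n + k + 1) * legendreCoeff n k := by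
  rcases le_or_gt k n with hk | hk
  · have h₁ := congrArg (Nat.cast : ℕ → R) (Nat.choose_succ_right_eq n k)
    have h₂ := congrArg (Nat.cast : ℕ → R) (Nat.add_one_mul_choose_eq (n + k) k)
    push_cast [legendreCoeff, Nat.cast_sub hk, ← add_assoc] at h₁ h₂ ⊢
    linear_combination ((n + k + 1).choose (k + 1) : R) * (k + 1) * h₁ -
      (n.choose k : R) * (n - k) * h₂
  · simp [eq_zero_of_lt hk, eq_zero_of_lt (show n < k + 1 by lia)]

theorem add_two_sub (n k : ℕ) :
    ((k : ℚ) + 1) * (legendreCoeff (n + 2) (k + 1) - legendreCoeff n (k + 1)) =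
      2 * (2 * n + 3) * legendreCoeff (n + 1) k := by
  have hk : (k : ℚ) + 1 ≠ 0 := by positivity
  have hl₁ := succ_left (R := ℚ) n k
  have hl₂ := succ_left (R := ℚ) (n + 1) k
  have hr₀ := succ_right (R := ℚ) n k
  have hr₂ := succ_right (R := ℚ) (n + 2) k
  push_cast at hl₂ hr₂
  apply mul_left_cancel₀ hk
  linear_combination hr₂ - hr₀ + (n + k + 3) * hl₂ + (n - k) * hl₁

theorem three_term (n k : ℕ) :
    ((n : ℚ) + 2) * legendreCoeff (n + 2) (k + 1) + (n + 1) * legendreCoeff n (k + 1) =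
      (2 * n + 3) * (legendreCoeff (n + 1) (k + 1) + 2 * legendreCoeff (n + 1) k) := by
  have hl₁ := succ_left (R := ℚ) n (k + 1)
  have hl₂ := succ_left (R := ℚ) (n + 1) (k + 1)
  push_cast at hl₁ hl₂
  linear_combination add_two_sub n k + hl₂ - hl₁

end legendreCoeff

/-- The sum `∑ k, C(n, k) C(n + k, k) (-1/2) ^ k f k`; for `f = 1` it is the value of the Legendre
polynomial of degree `n` at `0`. -/
def legendreSum (f : ℕ → ℚ) (n : ℕ) : ℚ :=
  ∑ k ∈ Finset.range (n + 1), legendreCoeff n k * (-1 / 2) ^ k * f k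

theorem legendreSum_eq_sum_range (f : ℕ → ℚ) {n N : ℕ} (h : n < N) :
    legendreSum f n = ∑ k ∈ Finset.range N, legendreCoeff n k * (-1 / 2) ^ k * f k := by
  refine Finset.sum_subset (Finset.range_mono h) fun k _ hk => ?_
  simp [legendreCoeff.eq_zero_of_lt (show n < k by simpa using hk)]

theorem legendreSum_add_two (f : ℕ → ℚ) (n : ℕ) :
    ((n : ℚ) + 2) * legendreSum f (n + 2) + (n + 1) * legendreSum f n =
      (2 * n + 3) * legendreSum (fun k => f k - f (k + 1)) (n + 1) := by
  let t (k : ℕ) : ℚ := (2 * n + 3) * legendreCoeff (n + 1) k * (-1 / 2) ^ k * f k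
  have summand_eq (k : ℕ) :
      ((n : ℚ) + 2) * (legendreCoeff (n + 2) (k + 1) * (-1 / 2) ^ (k + 1) * f (k + 1)) +
        (n + 1) * (legendreCoeff n (k + 1) * (-1 / 2) ^ (k + 1) * f (k + 1)) =
      (2 * n + 3) * (legendreCoeff (n + 1) k * (-1 / 2) ^ k * (f k - f (k + 1))) +
        (t (k + 1) - t k) := by
    linear_combination (-1 / 2 : ℚ) ^ (k + 1) * f (k + 1) * legendreCoeff.three_term n k
  rw [legendreSum_eq_sum_range f (show n < n + 2 + 1 by lia), legendreSum, legendreSum,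
    Finset.mul_sum, Finset.mul_sum, ← Finset.sum_add_distrib, Finset.sum_range_succ',
    Finset.sum_congr rfl fun k _ => summand_eq k, Finset.sum_add_distrib, Finset.sum_range_sub,
    Finset.mul_sum]
  simp only [t, legendreCoeff.zero_right, legendreCoeff.eq_zero_of_lt (show n + 1 < n + 2 by lia)]
  ring

theorem legendreSum_one_add_two (n : ℕ) :
    ((n : ℚ) + 2) * legendreSum 1 (n + 2) = -((n + 1) * legendreSum 1 n) := by
  rw [eq_neg_iff_add_eq_zero, legendreSum_add_two]
  simp [legendreSum]

theorem legendreSum_harmonic_add_two (n : ℕ) :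
    ((n : ℚ) + 2) * legendreSum harmonic (n + 2) + (n + 1) * legendreSum harmonic n =
      legendreSum 1 (n + 2) - legendreSum 1 n := by
  rw [legendreSum_add_two, legendreSum_eq_sum_range 1 (show n < n + 2 + 1 by lia), legendreSum,
    legendreSum, ← Finset.sum_sub_distrib, Finset.sum_range_succ' _ (n + 2), Finset.mul_sum]
  simp only [legendreCoeff.zero_right, sub_self, add_zero]
  refine Finset.sum_congr rfl fun k _ => ?_
  have hk : (k : ℚ) + 1 ≠ 0 := by positivity
  have hc : (2 * (n : ℚ) + 3) * legendreCoeff (n + 1) k / (k + 1) =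
      (legendreCoeff (n + 2) (k + 1) - legendreCoeff n (k + 1)) / 2 := by
    rw [div_eq_div_iff hk two_ne_zero]
    linear_combination -legendreCoeff.add_two_sub n k
  rw [harmonic_succ, Pi.one_apply]
  push_cast
  linear_combination -(-1 / 2 : ℚ) ^ k * hc

theorem legendreSum_one_two_mul_add_one (m : ℕ) : legendreSum 1 (2 * m + 1) = 0 := by
  induction m with
  | zero => norm_num [legendreSum, legendreCoeff, Finset.sum_range_succ]
  | succ m ih =>
    have h := legendreSum_one_add_two (2 * m + 1)
    rw [ih, mul_zero, neg_zero] at h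
    exact (mul_eq_zero.1 h).resolve_left (by positivity)

theorem legendreSum_one_two_mul (m : ℕ) :
    legendreSum 1 (2 * m) * m.factorial = (-1) ^ m * ∏ j ∈ Finset.range m, (1 / 2 + j : ℚ) := by
  induction m with
  | zero => simp [legendreSum, legendreCoeff]
  | succ m ih =>
    have h := legendreSum_one_add_two (2 * m)
    rw [Nat.factorial_succ, Finset.prod_range_succ, show 2 * (m + 1) = 2 * m + 2 by ring]
    push_cast at h ⊢
    linear_combination (m.factorial : ℚ) / 2 * h - (m + 1 / 2 : ℚ) * ih

theorem legendreSum_harmonic_two_mul (m : ℕ) :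
    legendreSum harmonic (2 * m) = legendreSum 1 (2 * m) * harmonic (2 * m) := by
  induction m with
  | zero => simp [legendreSum]
  | succ m ih =>
    have h₁ := legendreSum_one_add_two (2 * m)
    have hH := legendreSum_harmonic_add_two (2 * m)
    rw [ih] at hH
    rw [show 2 * (m + 1) = 2 * m + 2 by ring, harmonic_succ, harmonic_succ]
    push_cast at h₁ hH ⊢
    have h₂ : (2 * (m : ℚ) + 2) ≠ 0 := by positivity
    have h₃ : (2 * (m : ℚ) + 1) ≠ 0 := by positivity
    have hP : legendreSum 1 (2 * m) = -((2 * m + 2) / (2 * m + 1) * legendreSum 1 (2 * m + 2)) := by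
      field_simp
      linear_combination h₁
    rw [hP] at hH
    field_simp at hH ⊢
    linear_combination hH

theorem legendreSum_harmonic_two_mul_add_one (m : ℕ) :
    legendreSum harmonic (2 * m + 1) * ∏ j ∈ Finset.range (m + 1), (1 / 2 + j : ℚ) =
      (-1) ^ (m + 1) * m.factorial / 2 := by
  induction m with
  | zero => norm_num [legendreSum, legendreCoeff, Finset.sum_range_succ]
  | succ m ih =>
    have h := legendreSum_harmonic_add_two (2 * m + 1)
    rw [show 2 * m + 1 + 2 = 2 * (m + 1) + 1 by ring, legendreSum_one_two_mul_add_one,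
      legendreSum_one_two_mul_add_one] at h
    rw [Nat.factorial_succ, Finset.prod_range_succ]
    push_cast at h ⊢
    linear_combination (1 / 2 : ℚ) * (∏ j ∈ Finset.range (m + 1), (1 / 2 + j : ℚ)) * h -
      (m + 1 : ℚ) * ih

theorem two_pow_mul_prod_odd (k : ℕ) :
    2 ^ k * ∏ j ∈ Finset.range k, (2 * j + 1) = k.factorial * k.centralBinom := by
  induction k with
  | zero => simp
  | succ k ih =>
    rw [Finset.prod_range_succ, Nat.factorial_succ, mul_right_comm (k + 1),
      mul_comm _ k.factorial, Nat.succ_mul_centralBinom_succ]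
    linear_combination 2 * (2 * k + 1) * ih

theorem factorial_sq_mul_legendreCoeff (n k : ℕ) :
    (k.factorial : ℤ) ^ 2 * (legendreCoeff n k * (-4) ^ k) =
      ∏ j ∈ Finset.range k, ((2 * (j : ℤ) + 1) ^ 2 - (2 * n + 1) ^ 2) := by
  induction k with
  | zero => simp [legendreCoeff]
  | succ k ih =>
    rw [Finset.prod_range_succ, ← ih, Nat.factorial_succ, Nat.cast_mul, Nat.cast_succ]
    linear_combination
      (k.factorial : ℤ) ^ 2 * (-4) ^ (k + 1) * legendreCoeff.succ_right (R := ℤ) n k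

theorem sq_dvd_factorial_sq_mul_centralBinom_sq_sub (n k : ℕ) :
    ((2 * n + 1 : ℕ) : ℤ) ^ 2 ∣
      (k.factorial : ℤ) ^ 2 * (k.centralBinom ^ 2 - legendreCoeff n k * (-16) ^ k) := by
  have hprod : ∏ j ∈ Finset.range k, ((2 * (j : ℤ) + 1) ^ 2 - (2 * n + 1) ^ 2) ≡
      ∏ j ∈ Finset.range k, (2 * (j : ℤ) + 1) ^ 2 [ZMOD (2 * n + 1) ^ 2] :=
    Int.ModEq.prod fun j _ => by simp [Int.modEq_iff_dvd]
  have hC : (2 : ℤ) ^ k * ∏ j ∈ Finset.range k, (2 * (j : ℤ) + 1) =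
      k.factorial * k.centralBinom := mod_cast two_pow_mul_prod_odd k
  have h16 : (-16 : ℤ) ^ k = (2 ^ k) ^ 2 * (-4) ^ k := by
    rw [← pow_mul, mul_comm k, pow_mul, ← mul_pow]; norm_num
  have hdiff : (k.factorial : ℤ) ^ 2 * (k.centralBinom ^ 2 - legendreCoeff n k * (-16) ^ k) =
      (2 ^ k) ^ 2 * (∏ j ∈ Finset.range k, (2 * (j : ℤ) + 1) ^ 2 -
        ∏ j ∈ Finset.range k, ((2 * (j : ℤ) + 1) ^ 2 - (2 * n + 1) ^ 2)) := by
    rw [← factorial_sq_mul_legendreCoeff, Finset.prod_pow, h16]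
    linear_combination -((k.factorial : ℤ) * k.centralBinom +
      2 ^ k * ∏ j ∈ Finset.range k, (2 * (j : ℤ) + 1)) * hC
  rw [hdiff]
  push_cast
  exact hprod.dvd.mul_left _

theorem prime_sq_dvd_centralBinom_sq_sub {n k : ℕ} (hp : (2 * n + 1).Prime)
    (hk : k < 2 * n + 1) :
    ((2 * n + 1 : ℕ) : ℤ) ^ 2 ∣ (k.centralBinom : ℤ) ^ 2 - legendreCoeff n k * (-16) ^ k := by
  have hcop : IsCoprime ((2 * n + 1 : ℕ) : ℤ) k.factorial :=
    Nat.isCoprime_iff_coprime.2 ((Nat.coprime_factorial_iff hp.ne_one).2 (by rwa [hp.minFac_eq]))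
  exact hcop.pow.dvd_of_dvd_mul_left (sq_dvd_factorial_sq_mul_centralBinom_sq_sub n k)

namespace PadicModEq

variable {p : ℕ} [Fact p.Prime] {n : ℕ} {a b c : ℚ_[p]}

theorem of_dvd {x y : ℤ_[p]} (h : (p : ℤ_[p]) ^ n ∣ x - y) : PadicModEq p n x y := by
  obtain ⟨z, hz⟩ := h
  exact ⟨z, by exact_mod_cast congrArg ((↑) : ℤ_[p] → ℚ_[p]) hz⟩

theorem intCast_of_dvd {a b : ℤ} (h : (p : ℤ) ^ n ∣ a - b) : PadicModEq p n a b := by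
  obtain ⟨z, hz⟩ := h
  refine ⟨z, ?_⟩
  rw [PadicInt.coe_intCast, ← Int.cast_sub, hz]
  push_cast
  rfl

theorem symm (h : PadicModEq p n a b) : PadicModEq p n b a := by
  obtain ⟨z, hz⟩ := h
  refine ⟨-z, ?_⟩
  push_cast
  linear_combination -hz

theorem trans (hab : PadicModEq p n a b) (hbc : PadicModEq p n b c) : PadicModEq p n a c := by
  obtain ⟨y, hy⟩ := hab
  obtain ⟨z, hz⟩ := hbc
  refine ⟨y + z, ?_⟩
  push_cast
  linear_combination hy + hz

theorem mul_left (z : ℤ_[p]) (h : PadicModEq p n a b) : PadicModEq p n (z * a) (z * b) := by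
  obtain ⟨y, hy⟩ := h
  refine ⟨z * y, ?_⟩
  push_cast
  linear_combination (z : ℚ_[p]) * hy

theorem sum {ι : Type*} {s : Finset ι} {f g : ι → ℚ_[p]}
    (h : ∀ i ∈ s, PadicModEq p n (f i) (g i)) :
    PadicModEq p n (∑ i ∈ s, f i) (∑ i ∈ s, g i) := by
  choose! z hz using h
  refine ⟨∑ i ∈ s, z i, ?_⟩
  rw [← Finset.sum_sub_distrib, Finset.sum_congr rfl hz, ← Finset.mul_sum, PadicInt.coe_sum]

end PadicModEq

section Harmonic

variable {p : ℕ} [Fact p.Prime]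

theorem natCast_mul_padicInt_inv {k : ℕ} (h₀ : k ≠ 0) (hk : k < p) :
    (k : ℤ_[p]) * PadicInt.inv (k : ℤ_[p]) = 1 :=
  PadicInt.mul_inv (PadicInt.norm_natCast_eq_one_iff.2 (Nat.coprime_of_lt_prime h₀ hk Fact.out))

theorem coe_padicInt_inv_natCast {k : ℕ} (h₀ : k ≠ 0) (hk : k < p) :
    (PadicInt.inv (k : ℤ_[p]) : ℚ_[p]) = (k : ℚ_[p])⁻¹ :=
  eq_inv_of_mul_eq_one_right
    (by exact_mod_cast congrArg ((↑) : ℤ_[p] → ℚ_[p]) (natCast_mul_padicInt_inv h₀ hk))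

/-- The harmonic number `H_k` as a `p`-adic integer. It is meaningful for `k < p` only, since
`PadicInt.inv` sends multiples of `p` to `0`. -/
noncomputable def padicHarmonic (p : ℕ) [Fact p.Prime] (k : ℕ) : ℤ_[p] :=
  ∑ j ∈ Finset.range k, PadicInt.inv ((j + 1 : ℕ) : ℤ_[p])

theorem coe_padicHarmonic {k : ℕ} (hk : k < p) :
    (padicHarmonic p k : ℚ_[p]) = (harmonic k : ℚ) := by
  rw [padicHarmonic, harmonic, PadicInt.coe_sum]
  push_cast
  refine Finset.sum_congr rfl fun j hj => ?_
  have hj : j < k := Finset.mem_range.1 hj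
  exact_mod_cast coe_padicInt_inv_natCast (p := p) (show j + 1 ≠ 0 by lia) (by lia)

theorem sum_centralBinom_sq_mul_harmonic_modEq {n : ℕ} (hn : p = 2 * n + 1) :
    PadicModEq p 2
      ((∑ k ∈ Finset.range p, (k.centralBinom : ℚ) ^ 2 * (harmonic k / 32 ^ k) : ℚ) : ℚ_[p])
      (legendreSum harmonic n : ℚ) := by
  have hp : p.Prime := Fact.out
  have hp₂ : 2 < p := by have := hp.two_le; lia
  have hu : (PadicInt.inv ((2 : ℕ) : ℤ_[p]) : ℚ_[p]) = 2⁻¹ :=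
    coe_padicInt_inv_natCast two_ne_zero hp₂
  rw [legendreSum_eq_sum_range harmonic (show n < p by lia)]
  push_cast
  refine PadicModEq.sum fun k hk => ?_
  have hk : k < p := Finset.mem_range.1 hk
  have hC : (p : ℤ) ^ 2 ∣ (k.centralBinom : ℤ) ^ 2 - legendreCoeff n k * (-16) ^ k := by
    subst hn
    exact prime_sq_dvd_centralBinom_sq_sub hp hk
  convert (PadicModEq.intCast_of_dvd hC).mul_left
    (PadicInt.inv ((2 : ℕ) : ℤ_[p]) ^ (5 * k) * padicHarmonic p k) using 1 <;>
    rw [PadicInt.coe_mul, PadicInt.coe_pow, hu, coe_padicHarmonic hk, pow_mul] <;>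
    push_cast
  · rw [show (32 : ℚ_[p]) = 2 ^ 5 by norm_num, inv_pow, inv_pow]
    ring
  · rw [show (-1 / 2 : ℚ_[p]) = 2⁻¹ ^ 5 * -16 by norm_num, mul_pow]
    ring

theorem pow_three_dvd_two_mul_prod_one_add_mul_sub {R : Type*} [CommRing R] (x : R) (a : ℕ → R)
    (n : ℕ) :
    x ^ 3 ∣ 2 * ∏ j ∈ Finset.range n, (1 + x * a j) -
      (2 + 2 * x * ∑ j ∈ Finset.range n, a j +
        x ^ 2 * ((∑ j ∈ Finset.range n, a j) ^ 2 - ∑ j ∈ Finset.range n, a j ^ 2)) := by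
  induction n with
  | zero => simp
  | succ n ih =>
    obtain ⟨r, hr⟩ := ih
    rw [Finset.prod_range_succ, Finset.sum_range_succ, Finset.sum_range_succ]
    refine ⟨r * (1 + x * a n) +
      a n * ((∑ j ∈ Finset.range n, a j) ^ 2 - ∑ j ∈ Finset.range n, a j ^ 2), ?_⟩
    linear_combination (1 + x * a n) * hr

theorem prod_add_one_sub_two_mul_add_one {R : Type*} [CommRing R] (n : ℕ) :
    ∏ j ∈ Finset.range n, ((j : R) + 1 - (2 * n + 1)) =
      2 ^ n * ∏ j ∈ Finset.range n, (2 * ((j : R) + 1) - (2 * n + 1)) := by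
  have hodd : 2 ^ n * ∏ j ∈ Finset.range n, (2 * (j : R) + 1) =
      ∏ j ∈ Finset.range n, ((n : R) + 1 + j) := by
    have h := two_pow_mul_prod_odd n
    rw [Nat.centralBinom, two_mul, ← Nat.ascFactorial_eq_factorial_mul_choose,
      Nat.ascFactorial_eq_prod_range] at h
    exact_mod_cast congrArg (Nat.cast : ℕ → R) h
  have hreflect (j : ℕ) (hj : j ∈ Finset.range n) : ((n - 1 - j : ℕ) : R) = n - 1 - j := by
    have hj : j < n := Finset.mem_range.1 hj
    rw [Nat.sub_sub, Nat.cast_sub (by lia)]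
    push_cast
    ring
  have hl : ∏ j ∈ Finset.range n, ((j : R) + 1 - (2 * n + 1)) =
      (-1) ^ n * ∏ j ∈ Finset.range n, ((n : R) + 1 + j) := by
    rw [← Finset.prod_range_reflect, Finset.prod_congr rfl fun (j : ℕ) hj =>
      show _ = -((n : R) + 1 + j) by rw [hreflect j hj]; ring, Finset.prod_neg, Finset.card_range]
  have hr : ∏ j ∈ Finset.range n, (2 * ((j : R) + 1) - (2 * n + 1)) =
      (-1) ^ n * ∏ j ∈ Finset.range n, (2 * (j : R) + 1) := by
    rw [← Finset.prod_range_reflect, Finset.prod_congr rfl fun (j : ℕ) hj =>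
      show _ = -(2 * (j : R) + 1) by rw [hreflect j hj]; ring, Finset.prod_neg, Finset.card_range]
  rw [hl, hr, ← hodd]
  ring

theorem isUnit_factorial_padicInt {k : ℕ} (hk : k < p) : IsUnit (k.factorial : ℤ_[p]) := by
  rw [PadicInt.isUnit_iff, PadicInt.norm_natCast_eq_one_iff]
  exact (Nat.coprime_factorial_iff (Fact.out : p.Prime).ne_one).2
    (by rwa [(Fact.out : p.Prime).minFac_eq])

theorem four_pow_mul_prod_one_sub_half {n : ℕ} (hn : p = 2 * n + 1) {u : ℤ_[p]}
    (hu : 2 * u = 1) :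
    4 ^ n * ∏ j ∈ Finset.range n, (1 + -p * (u * PadicInt.inv ((j + 1 : ℕ) : ℤ_[p]))) =
      ∏ j ∈ Finset.range n, (1 + -p * PadicInt.inv ((j + 1 : ℕ) : ℤ_[p])) := by
  have hpn : (p : ℤ_[p]) = 2 * n + 1 := by exact_mod_cast congrArg (Nat.cast : ℕ → ℤ_[p]) hn
  have hinv (j : ℕ) (hj : j ∈ Finset.range n) :
      ((j : ℤ_[p]) + 1) * PadicInt.inv ((j + 1 : ℕ) : ℤ_[p]) = 1 := by
    have hj : j < n := Finset.mem_range.1 hj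
    exact_mod_cast natCast_mul_padicInt_inv (p := p) (show j + 1 ≠ 0 by lia) (by lia)
  have hfac : (n.factorial : ℤ_[p]) = ∏ j ∈ Finset.range n, ((j : ℤ_[p]) + 1) := by
    exact_mod_cast congrArg (Nat.cast : ℕ → ℤ_[p]) (Finset.prod_range_add_one_eq_factorial n).symm
  have hl : 2 ^ n * n.factorial *
      ∏ j ∈ Finset.range n, (1 + -p * (u * PadicInt.inv ((j + 1 : ℕ) : ℤ_[p]))) =
      ∏ j ∈ Finset.range n, (2 * ((j : ℤ_[p]) + 1) - p) := by
    nth_rw 1 [hfac, ← Finset.card_range n]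
    rw [Finset.pow_card_mul_prod, ← Finset.prod_mul_distrib]
    refine Finset.prod_congr rfl fun j hj => ?_
    linear_combination -2 * u * p * hinv j hj - p * hu
  have hr : n.factorial * ∏ j ∈ Finset.range n, (1 + -p * PadicInt.inv ((j + 1 : ℕ) : ℤ_[p])) =
      ∏ j ∈ Finset.range n, ((j : ℤ_[p]) + 1 - p) := by
    rw [hfac, ← Finset.prod_mul_distrib]
    refine Finset.prod_congr rfl fun j hj => ?_
    linear_combination -(p : ℤ_[p]) * hinv j hj
  apply (isUnit_factorial_padicInt (p := p) (show n < p by lia)).mul_left_cancel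
  rw [hr, hpn, prod_add_one_sub_two_mul_add_one, ← hpn, ← hl, show (4 : ℤ_[p]) = 2 * 2 by norm_num,
    mul_pow]
  ring

theorem sum_inv_sq_zmod (hp : 3 < p) : ∑ x : ZMod p, x⁻¹ ^ 2 = 0 := by
  rw [Fintype.sum_equiv (Equiv.inv (ZMod p)) (fun x => x⁻¹ ^ 2) (fun x => x ^ 2) fun _ => rfl]
  exact FiniteField.sum_pow_lt_card_sub_one (ZMod p) 2 (by rw [ZMod.card]; lia)

theorem sum_zmod_eq_sum_range {M : Type*} [AddCommMonoid M] {m : ℕ} [NeZero m] (f : ZMod m → M) :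
    ∑ x : ZMod m, f x = ∑ j ∈ Finset.range m, f j :=
  Finset.sum_nbij' ZMod.val Nat.cast (fun x _ => Finset.mem_range.2 x.val_lt)
    (fun _ _ => Finset.mem_univ _) (fun x _ => x.natCast_zmod_val)
    (fun _ hj => ZMod.val_cast_of_lt (Finset.mem_range.1 hj))
    fun x _ => by rw [x.natCast_zmod_val]

theorem toZMod_padicInt_inv_natCast {k : ℕ} (h₀ : k ≠ 0) (hk : k < p) :
    PadicInt.toZMod (PadicInt.inv (k : ℤ_[p])) = (k : ZMod p)⁻¹ := by
  refine eq_inv_of_mul_eq_one_right ?_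
  rw [← map_natCast PadicInt.toZMod k, ← map_mul, natCast_mul_padicInt_inv h₀ hk, map_one]

theorem dvd_iff_toZMod_eq_zero (x : ℤ_[p]) : (p : ℤ_[p]) ∣ x ↔ PadicInt.toZMod x = 0 := by
  rw [← RingHom.mem_ker, PadicInt.ker_toZMod, PadicInt.maximalIdeal_eq_span_p,
    Ideal.mem_span_singleton]

theorem dvd_sum_padicInt_inv_sq (hp : 3 < p) {n : ℕ} (hn : p = 2 * n + 1) :
    (p : ℤ_[p]) ∣ ∑ j ∈ Finset.range n, PadicInt.inv ((j + 1 : ℕ) : ℤ_[p]) ^ 2 := by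
  have hmap : PadicInt.toZMod (∑ j ∈ Finset.range n, PadicInt.inv ((j + 1 : ℕ) : ℤ_[p]) ^ 2) =
      ∑ j ∈ Finset.range n, ((j + 1 : ℕ) : ZMod p)⁻¹ ^ 2 := by
    rw [map_sum]
    refine Finset.sum_congr rfl fun j hj => ?_
    have hj : j < n := Finset.mem_range.1 hj
    rw [map_pow, toZMod_padicInt_inv_natCast (by lia) (by lia)]
  have hreflect : ∑ j ∈ Finset.range n, ((n + j + 1 : ℕ) : ZMod p)⁻¹ ^ 2 =
      ∑ j ∈ Finset.range n, ((j + 1 : ℕ) : ZMod p)⁻¹ ^ 2 := by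
    rw [← Finset.sum_range_reflect]
    refine Finset.sum_congr rfl fun j hj => ?_
    have hj : j < n := Finset.mem_range.1 hj
    have hneg : ((n + (n - 1 - j) + 1 : ℕ) : ZMod p) = -((j + 1 : ℕ) : ZMod p) := by
      rw [eq_neg_iff_add_eq_zero, ← Nat.cast_add, show n + (n - 1 - j) + 1 + (j + 1) = p by lia,
        ZMod.natCast_self]
    rw [hneg, inv_neg, neg_sq]
  have hsum : ∑ x : ZMod p, x⁻¹ ^ 2 =
      2 * ∑ j ∈ Finset.range n, ((j + 1 : ℕ) : ZMod p)⁻¹ ^ 2 := by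
    rw [sum_zmod_eq_sum_range, show Finset.range p = Finset.range (n + n + 1) by congr 1; lia,
      Finset.sum_range_succ', Finset.sum_range_add, hreflect]
    simp [two_mul]
  have h2 : (2 : ZMod p) ≠ 0 := Ring.two_ne_zero (by rw [ZMod.ringChar_zmod_n]; lia)
  rw [dvd_iff_toZMod_eq_zero, hmap]
  exact (mul_eq_zero.1 (hsum.symm.trans (sum_inv_sq_zmod hp))).resolve_left h2

theorem sq_dvd_padicHarmonic_add (hp : 3 < p) {n : ℕ} (hn : p = 2 * n + 1) {q : ℤ_[p]}
    (hq : 2 ^ (p - 1) = 1 + p * q) :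
    (p : ℤ_[p]) ^ 2 ∣ padicHarmonic p n + (2 * q - p * q ^ 2) := by
  have hp₀ : (p : ℤ_[p]) ≠ 0 := PadicInt.prime_p.ne_zero
  have hu : 2 * PadicInt.inv ((2 : ℕ) : ℤ_[p]) = 1 := by
    exact_mod_cast natCast_mul_padicInt_inv (p := p) two_ne_zero (by lia)
  have h4 : (4 : ℤ_[p]) ^ n = 1 + p * q := by
    rw [← hq, show p - 1 = 2 * n by lia, pow_mul]
    norm_num
  generalize PadicInt.inv ((2 : ℕ) : ℤ_[p]) = u at hu
  have hprod := four_pow_mul_prod_one_sub_half hn hu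
  obtain ⟨s, hs⟩ := dvd_sum_padicInt_inv_sq hp hn
  obtain ⟨r₁, h₁⟩ := pow_three_dvd_two_mul_prod_one_add_mul_sub (-p : ℤ_[p])
    (fun j => PadicInt.inv ((j + 1 : ℕ) : ℤ_[p])) n
  obtain ⟨r₂, h₂⟩ := pow_three_dvd_two_mul_prod_one_add_mul_sub (-p : ℤ_[p])
    (fun j => u * PadicInt.inv ((j + 1 : ℕ) : ℤ_[p])) n
  simp only [mul_pow, ← Finset.mul_sum] at h₁ h₂
  rw [← hprod, h4, hs, ← padicHarmonic] at h₁
  rw [hs, ← padicHarmonic] at h₂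
  generalize padicHarmonic p n = H at *
  have hu' : 4 * u ^ 2 = 1 := by linear_combination (2 * u + 1) * hu
  -- A quadratic relation for `H` modulo `p ^ 2`: it gives `H` modulo `p`, which linearises it.
  obtain ⟨w, hw⟩ : (p : ℤ_[p]) ^ 2 ∣ 8 * q + 4 * H - 4 * p * q * H - 3 * p * H ^ 2 := by
    refine ⟨(1 + p * q) * (s + 4 * r₂) - q * H ^ 2 - 4 * s - 4 * r₁, mul_left_cancel₀ hp₀ ?_⟩
    linear_combination 4 * h₁ - 4 * (1 + p * q) * h₂ + 4 * p * (1 + p * q) * H * hu -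
      p ^ 2 * (1 + p * q) * (H ^ 2 - p * s) * hu'
  obtain ⟨t, ht⟩ : (p : ℤ_[p]) ∣ H + 2 * q :=
    ⟨u ^ 2 * (p * w + 4 * q * H + 3 * H ^ 2), by
      linear_combination u ^ 2 * hw - (H + 2 * q) * hu'⟩
  refine ⟨u ^ 2 * (w - 8 * q * t + 3 * p * t ^ 2), ?_⟩
  obtain rfl : H = p * t - 2 * q := by linear_combination ht
  linear_combination u ^ 2 * hw - (p * t - p * q ^ 2) * hu'

theorem exists_intCast_eq_fermatQuotient {a : ℤ} (ha : IsCoprime a p) :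
    ∃ q : ℤ, a ^ (p - 1) = 1 + p * q ∧ fermatQuotient p a = q := by
  obtain ⟨q, hq⟩ := (Int.ModEq.pow_card_sub_one_eq_one Fact.out ha).symm.dvd
  have hp₀ : (p : ℚ) ≠ 0 := mod_cast (Fact.out : p.Prime).ne_zero
  refine ⟨q, by lia, ?_⟩
  rw [fermatQuotient, div_eq_iff hp₀]
  exact_mod_cast hq.trans (mul_comm _ _)

theorem harmonic_modEq_fermatQuotient (hp : 3 < p) {n : ℕ} (hn : p = 2 * n + 1) :
    PadicModEq p 2 (harmonic n : ℚ)
      ((-(2 * fermatQuotient p 2 - p * fermatQuotient p 2 ^ 2) : ℚ) : ℚ_[p]) := by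
  obtain ⟨q, hq, hfq⟩ := exists_intCast_eq_fermatQuotient (p := p) (a := 2)
    (by rw [hn]; exact ⟨-n, 1, by push_cast; ring⟩)
  have h := sq_dvd_padicHarmonic_add hp hn (q := q)
    (by exact_mod_cast congrArg (Int.cast : ℤ → ℤ_[p]) hq)
  rw [← sub_neg_eq_add] at h
  rw [hfq, ← coe_padicHarmonic (show n < p by lia)]
  convert PadicModEq.of_dvd h using 1
  push_cast
  rfl

end Harmonic

section Gamma

theorem isClosed_setOf_dvd {R : Type*} [Monoid R] [TopologicalSpace R] [ContinuousMul R]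
    [CompactSpace R] [T2Space R] (a : R) : IsClosed {b | a ∣ b} := by
  have hrange : {b | a ∣ b} = Set.range (a * ·) := by
    ext b
    simp only [Set.mem_ofPred_eq, Set.mem_range, dvd_def, eq_comm]
  rw [hrange]
  exact (isCompact_range (continuous_const_mul a)).isClosed

theorem moritaSeq_succ_of_coprime {p n : ℕ} (h : n.Coprime p) :
    moritaSeq p (n + 1) = -n * moritaSeq p n := by
  rw [moritaSeq, moritaSeq, Finset.range_add_one, Finset.filter_insert, if_pos h,
    Finset.prod_insert (by simp)]
  ring

theorem moritaSeq_succ_of_not_coprime {p n : ℕ} (h : ¬n.Coprime p) :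
    moritaSeq p (n + 1) = -moritaSeq p n := by
  rw [moritaSeq, moritaSeq, Finset.range_add_one, Finset.filter_insert, if_neg h]
  ring

variable {p : ℕ} [Fact p.Prime]

theorem eqOn_of_forall_natCast_mem {X : Type*} [TopologicalSpace X] [T2Space X]
    {f g : ℤ_[p] → X} (hf : Continuous f) (hg : Continuous g) {U : Set ℤ_[p]} (hU : IsOpen U)
    (h : ∀ n : ℕ, (n : ℤ_[p]) ∈ U → f n = g n) : Set.EqOn f g U := by
  have hdense : U ⊆ closure (U ∩ Set.range Nat.cast) :=
    PadicInt.denseRange_natCast.open_subset_closure_inter hU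
  refine (Set.EqOn.closure ?_ hf hg).mono hdense
  rintro _ ⟨hn, n, rfl⟩
  exact h n hn

theorem isUnit_iff_not_dvd {x : ℤ_[p]} : IsUnit x ↔ ¬(p : ℤ_[p]) ∣ x := by
  rw [← PadicInt.norm_lt_one_iff_dvd, ← PadicInt.not_isUnit_iff, not_not]

theorem isUnit_natCast_iff_coprime {n : ℕ} : IsUnit (n : ℤ_[p]) ↔ n.Coprime p := by
  rw [PadicInt.isUnit_iff, PadicInt.norm_natCast_eq_one_iff, Nat.coprime_comm]

theorem isUnit_add_of_dvd {x y : ℤ_[p]} (hx : IsUnit x) (hy : (p : ℤ_[p]) ∣ y) :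
    IsUnit (x + y) := by
  rw [isUnit_iff_not_dvd] at hx ⊢
  rwa [dvd_add_left hy]

theorem padicGamma_zero (hp : p ≠ 2) : padicGamma p 0 = 1 := by
  simpa [moritaSeq] using padicGamma_natCast p hp 0

theorem padicGamma_add_one_of_isUnit (hp : p ≠ 2) {x : ℤ_[p]} (hx : IsUnit x) :
    padicGamma p (x + 1) = -x * padicGamma p x := by
  have hΓ := continuous_padicGamma p hp
  refine eqOn_of_forall_natCast_mem (f := fun x => padicGamma p (x + 1))
    (g := fun x => -x * padicGamma p x) (by fun_prop) (by fun_prop) Units.isOpen (fun n hn => ?_) hx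
  rw [← Nat.cast_succ, padicGamma_natCast p hp, padicGamma_natCast p hp,
    moritaSeq_succ_of_coprime (isUnit_natCast_iff_coprime.1 hn)]
  push_cast
  rfl

theorem padicGamma_add_one_of_dvd (hp : p ≠ 2) {x : ℤ_[p]} (hx : (p : ℤ_[p]) ∣ x) :
    padicGamma p (x + 1) = -padicGamma p x := by
  have hΓ := continuous_padicGamma p hp
  have hopen : IsOpen {x : ℤ_[p] | (p : ℤ_[p]) ∣ x} := by
    simp only [← PadicInt.norm_lt_one_iff_dvd]
    exact isOpen_lt continuous_norm continuous_const
  refine eqOn_of_forall_natCast_mem (f := fun x => padicGamma p (x + 1))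
    (g := fun x => -padicGamma p x) (by fun_prop) (by fun_prop) hopen (fun n hn => ?_) hx
  rw [← Nat.cast_succ, padicGamma_natCast p hp, padicGamma_natCast p hp,
    moritaSeq_succ_of_not_coprime fun h => isUnit_iff_not_dvd.1 (isUnit_natCast_iff_coprime.2 h) hn]
  push_cast
  rfl

theorem padicGamma_add_natCast (hp : p ≠ 2) {x : ℤ_[p]} {m : ℕ}
    (hx : ∀ j < m, IsUnit (x + j)) :
    padicGamma p (x + m) = (-1) ^ m * (∏ j ∈ Finset.range m, (x + j)) * padicGamma p x := by
  induction m with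
  | zero => simp
  | succ m ih =>
    rw [Nat.cast_succ, ← add_assoc, padicGamma_add_one_of_isUnit hp (hx m m.lt_succ_self),
      ih fun j hj => hx j (hj.trans m.lt_succ_self), Finset.prod_range_succ]
    ring

theorem padicGamma_one_sub (hp : p ≠ 2) {x : ℤ_[p]} {m : ℕ} (hx : ∀ j < m, IsUnit (x + j)) :
    padicGamma p (1 - x) = (∏ j ∈ Finset.range m, (x + j)) * padicGamma p (1 - x - m) := by
  induction m with
  | zero => simp
  | succ m ih =>
    have hstep := padicGamma_add_one_of_isUnit hp (hx m m.lt_succ_self).neg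
    rw [ih fun j hj => hx j (hj.trans m.lt_succ_self), Finset.prod_range_succ,
      show 1 - x - m = -(x + m) + 1 by ring, hstep, Nat.cast_succ,
      show 1 - x - (m + 1) = -(x + m) by ring]
    ring

theorem padicGamma_add_one_mul_padicGamma_neg_of_isUnit (hp : p ≠ 2) {x : ℤ_[p]}
    (hx : IsUnit x) :
    padicGamma p (x + 1) * padicGamma p (-x) = -(padicGamma p x * padicGamma p (1 - x)) := by
  rw [padicGamma_add_one_of_isUnit hp hx, sub_eq_neg_add, padicGamma_add_one_of_isUnit hp hx.neg]
  ring

theorem padicGamma_add_one_mul_padicGamma_neg_of_dvd (hp : p ≠ 2) {x : ℤ_[p]}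
    (hx : (p : ℤ_[p]) ∣ x) :
    padicGamma p (x + 1) * padicGamma p (-x) = padicGamma p x * padicGamma p (1 - x) := by
  rw [padicGamma_add_one_of_dvd hp hx, sub_eq_neg_add, padicGamma_add_one_of_dvd hp hx.neg_right]
  ring

theorem padicGamma_add_natCast_add_one_mul (hp : p ≠ 2) {x : ℤ_[p]} (hx : (p : ℤ_[p]) ∣ x)
    {a : ℕ} (ha : a < p) :
    padicGamma p (x + a + 1) * padicGamma p (-(x + a)) =
      (-1) ^ a * (padicGamma p x * padicGamma p (1 - x)) := by
  induction a with
  | zero => simpa using padicGamma_add_one_mul_padicGamma_neg_of_dvd hp hx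
  | succ a ih =>
    have hunit : IsUnit (x + (a + 1 : ℕ)) := by
      rw [add_comm]
      exact isUnit_add_of_dvd (isUnit_natCast_iff_coprime.2
        (Nat.coprime_of_lt_prime a.succ_ne_zero ha Fact.out).symm) hx
    rw [padicGamma_add_one_mul_padicGamma_neg_of_isUnit hp hunit, Nat.cast_succ, ← add_assoc,
      show 1 - (x + a + 1) = -(x + a) by ring, ih (by lia)]
    ring

theorem padicGamma_mul_padicGamma_one_sub_of_dvd (hp : p ≠ 2) {x : ℤ_[p]}
    (hx : (p : ℤ_[p]) ∣ x) : padicGamma p x * padicGamma p (1 - x) = -1 := by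
  obtain ⟨y, rfl⟩ := hx
  have hΓ := continuous_padicGamma p hp
  refine PadicInt.denseRange_natCast.induction_on y
    (isClosed_eq (by fun_prop) continuous_const) fun n => ?_
  induction n with
  | zero =>
    have h := padicGamma_add_one_of_dvd hp (dvd_zero (p : ℤ_[p]))
    rw [zero_add] at h
    simp [h, padicGamma_zero hp]
  | succ n ih =>
    have hlast : (p : ℤ_[p]) * (n + 1 : ℕ) = p * n + (p - 1 : ℕ) + 1 := by
      rw [Nat.cast_pred (Fact.out : p.Prime).pos]
      push_cast
      ring
    have h := padicGamma_add_natCast_add_one_mul hp (dvd_mul_right (p : ℤ_[p]) n)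
      (Nat.sub_one_lt (Fact.out : p.Prime).ne_zero)
    rw [hlast, show 1 - ((p : ℤ_[p]) * n + (p - 1 : ℕ) + 1) = -(p * n + (p - 1 : ℕ)) by ring, h, ih,
      ((Fact.out : p.Prime).even_sub_one hp).neg_one_pow, one_mul]

theorem padicGamma_mul_padicGamma_neg_of_dvd (hp : p ≠ 2) {x : ℤ_[p]} (hx : (p : ℤ_[p]) ∣ x) :
    padicGamma p x * padicGamma p (-x) = 1 := by
  have h := padicGamma_mul_padicGamma_one_sub_of_dvd hp hx
  rw [sub_eq_neg_add, padicGamma_add_one_of_dvd hp hx.neg_right] at h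
  linear_combination -h

theorem padicGamma_sq_of_two_mul_eq_one {n : ℕ} (hn : p = 2 * n + 1) {u : ℤ_[p]}
    (hu : 2 * u = 1) : padicGamma p u ^ 2 = (-1) ^ (n + 1) := by
  have hp : p ≠ 2 := by lia
  have hx : (p : ℤ_[p]) ∣ -p * u := ⟨-u, by ring⟩
  have hpn : (p : ℤ_[p]) = 2 * n + 1 := by exact_mod_cast congrArg (Nat.cast : ℕ → ℤ_[p]) hn
  have h := padicGamma_add_natCast_add_one_mul hp hx (show n < p by lia)
  rw [padicGamma_mul_padicGamma_one_sub_of_dvd hp hx,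
    show -p * u + n + 1 = u by rw [hpn]; linear_combination -(n + 1 : ℤ_[p]) * hu,
    show -(-p * u + n) = u by rw [hpn]; linear_combination (n : ℤ_[p]) * hu] at h
  rw [sq, h, pow_succ]

theorem sq_dvd_padicGamma_add_mul_padicGamma_sub_sub_sq (hp : p ≠ 2) {t : ℤ_[p]}
    (ht : (p : ℤ_[p]) ∣ t) (x : ℤ_[p]) :
    t ^ 2 ∣ padicGamma p (x + t) * padicGamma p (x - t) - padicGamma p x ^ 2 := by
  have hΓ := continuous_padicGamma p hp
  refine PadicInt.denseRange_natCast.induction_on x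
    ((isClosed_setOf_dvd (t ^ 2)).preimage (f := fun x => padicGamma p (x + t) *
      padicGamma p (x - t) - padicGamma p x ^ 2) (by fun_prop)) fun n => ?_
  induction n with
  | zero => simp [padicGamma_zero hp, padicGamma_mul_padicGamma_neg_of_dvd hp ht]
  | succ n ih =>
    rw [Nat.cast_succ, add_right_comm, add_sub_right_comm]
    by_cases hn : IsUnit (n : ℤ_[p])
    · have hsub : IsUnit ((n : ℤ_[p]) - t) := by
        rw [sub_eq_add_neg]
        exact isUnit_add_of_dvd hn ht.neg_right
      rw [padicGamma_add_one_of_isUnit hp hn, padicGamma_add_one_of_isUnit hp hsub,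
        padicGamma_add_one_of_isUnit hp (isUnit_add_of_dvd hn ht)]
      refine (dvd_sub (ih.mul_left ((n : ℤ_[p]) ^ 2)) (dvd_mul_right (t ^ 2)
        (padicGamma p (n + t) * padicGamma p (n - t)))).trans (dvd_of_eq ?_)
      ring
    · have hn : (p : ℤ_[p]) ∣ n := not_not.1 (isUnit_iff_not_dvd.not.1 hn)
      rw [padicGamma_add_one_of_dvd hp hn, padicGamma_add_one_of_dvd hp (dvd_add hn ht),
        padicGamma_add_one_of_dvd hp (dvd_sub hn ht), neg_mul_neg, neg_sq]
      exact ih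

end Gamma

section Congruences

variable {p : ℕ} [Fact p.Prime]

theorem isUnit_one_add_natCast {j : ℕ} (hj : j + 1 < p) : IsUnit (1 + j : ℤ_[p]) := by
  rw [add_comm, ← Nat.cast_succ, isUnit_natCast_iff_coprime]
  exact (Nat.coprime_of_lt_prime j.succ_ne_zero hj Fact.out).symm

theorem isUnit_add_natCast_of_two_mul_eq_one {u : ℤ_[p]} (hu : 2 * u = 1) {j : ℕ}
    (hj : 2 * j + 1 < p) : IsUnit (u + j) := by
  have hodd : 2 * (u + j) = 1 + (2 * j : ℕ) := by
    push_cast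
    linear_combination hu
  exact isUnit_of_mul_isUnit_right (hodd ▸ isUnit_one_add_natCast hj)

theorem coe_eq_half_of_two_mul_eq_one {u : ℤ_[p]} (hu : 2 * u = 1) : (u : ℚ_[p]) = 1 / 2 := by
  rw [eq_div_iff two_ne_zero, mul_comm]
  exact_mod_cast congrArg ((↑) : ℤ_[p] → ℚ_[p]) hu

theorem coe_prod_add_natCast_of_two_mul_eq_one {u : ℤ_[p]} (hu : 2 * u = 1) (m : ℕ) :
    ((∏ j ∈ Finset.range m, (u + j) : ℤ_[p]) : ℚ_[p]) =
      (∏ j ∈ Finset.range m, (1 / 2 + j : ℚ) : ℚ) := by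
  induction m with
  | zero => simp
  | succ m ih =>
    rw [Finset.prod_range_succ, Finset.prod_range_succ, PadicInt.coe_mul, ih, Rat.cast_mul]
    push_cast
    rw [coe_eq_half_of_two_mul_eq_one hu]

theorem prod_one_add_natCast {R : Type*} [CommSemiring R] (m : ℕ) :
    ∏ j ∈ Finset.range m, (1 + j : R) = m.factorial := by
  rw [← Finset.prod_range_add_one_eq_factorial]
  push_cast
  simp only [add_comm]

theorem padicGamma_natCast_add_one (hp : p ≠ 2) {m : ℕ} (hm : m < p) :
    padicGamma p (m + 1) = (-1) ^ (m + 1) * m.factorial := by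
  have hone : padicGamma p 1 = -1 := by
    simpa [padicGamma_zero hp] using padicGamma_add_one_of_dvd hp (dvd_zero (p : ℤ_[p]))
  rw [add_comm (m : ℤ_[p]),
    padicGamma_add_natCast hp fun j hj => isUnit_one_add_natCast (by lia),
    prod_one_add_natCast, hone]
  ring

theorem factorial_mul_padicGamma_neg_natCast (hp : p ≠ 2) {m : ℕ} (hm : m < p) :
    m.factorial * padicGamma p (-m) = 1 := by
  have h := padicGamma_one_sub hp (x := 1) (m := m) fun j hj => isUnit_one_add_natCast (by lia)
  rwa [sub_self, zero_sub, prod_one_add_natCast, padicGamma_zero hp, eq_comm] at h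

theorem legendreSum_one_two_mul_mul_padicGamma (hp : p ≠ 2) {u : ℤ_[p]} (hu : 2 * u = 1) {m : ℕ}
    (hm : 2 * m < p) :
    (legendreSum 1 (2 * m) : ℚ_[p]) * padicGamma p u =
      padicGamma p (u + m) * padicGamma p (-m) := by
  have hadd := padicGamma_add_natCast hp (x := u) (m := m) fun j hj =>
    isUnit_add_natCast_of_two_mul_eq_one hu (by lia)
  have hneg := congrArg ((↑) : ℤ_[p] → ℚ_[p])
    (factorial_mul_padicGamma_neg_natCast hp (show m < p by lia))
  have hP := congrArg (Rat.cast : ℚ → ℚ_[p]) (legendreSum_one_two_mul m)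
  rw [Rat.cast_mul, Rat.cast_mul, ← coe_prod_add_natCast_of_two_mul_eq_one hu] at hP
  rw [hadd]
  push_cast at hneg hP ⊢
  linear_combination (padicGamma p u : ℚ_[p]) * padicGamma p (-m) * hP -
    (legendreSum 1 (2 * m) : ℚ_[p]) * padicGamma p u * hneg

theorem legendreSum_harmonic_two_mul_add_one_mul_padicGamma (hp : p ≠ 2) {u : ℤ_[p]}
    (hu : 2 * u = 1) {m : ℕ} (hm : 2 * m + 1 < p) :
    (legendreSum harmonic (2 * m + 1) : ℚ_[p]) * padicGamma p u =
      1 / 2 * (padicGamma p (m + 1) * padicGamma p (-(u + m))) := by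
  have hsub := padicGamma_one_sub hp (x := u) (m := m + 1) fun j hj =>
    isUnit_add_natCast_of_two_mul_eq_one hu (by lia)
  rw [show 1 - u = u by linear_combination -hu, Nat.cast_succ,
    show u - (m + 1) = -(u + m) by linear_combination hu] at hsub
  have hS := congrArg (Rat.cast : ℚ → ℚ_[p]) (legendreSum_harmonic_two_mul_add_one m)
  rw [Rat.cast_mul, ← coe_prod_add_natCast_of_two_mul_eq_one hu] at hS
  rw [padicGamma_natCast_add_one hp (show m < p by lia), hsub]
  push_cast at hS ⊢
  linear_combination (padicGamma p (-(u + m)) : ℚ_[p]) * hS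

theorem padicGamma_mul_padicGamma_modEq_sq (hp : p ≠ 2) {x y z : ℤ_[p]} (hy : y = x + p * x)
    (hz : z = x - p * x) :
    PadicModEq p 2 (padicGamma p y * padicGamma p z : ℤ_[p]) (padicGamma p x ^ 2 : ℤ_[p]) := by
  subst hy hz
  exact PadicModEq.of_dvd ((pow_dvd_pow_of_dvd (dvd_mul_right _ x) 2).trans
    (sq_dvd_padicGamma_add_mul_padicGamma_sub_sub_sq hp (dvd_mul_right _ x) x))

theorem legendreSum_harmonic_two_mul_modEq (hp : 3 < p) {m : ℕ} (hm : p = 4 * m + 1)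
    {u x : ℤ_[p]} (hu : 2 * u = 1) (hx : 4 * x = 1) :
    PadicModEq p 2 (legendreSum harmonic (2 * m) : ℚ)
      (padicGamma p u * padicGamma p x ^ 2 *
        (2 * fermatQuotient p 2 - p * fermatQuotient p 2 ^ 2 : ℚ)) := by
  have hn : p = 2 * (2 * m) + 1 := by lia
  have hpm : (p : ℤ_[p]) = 4 * m + 1 := by exact_mod_cast congrArg (Nat.cast : ℕ → ℤ_[p]) hm
  obtain rfl : u = 2 * x := by linear_combination 2 * x * hu - u * hx
  have hsq : (padicGamma p (2 * x) : ℚ_[p]) ^ 2 = -1 := by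
    have h := padicGamma_sq_of_two_mul_eq_one hn hu
    rw [(odd_two_mul_add_one m).neg_one_pow] at h
    exact_mod_cast congrArg ((↑) : ℤ_[p] → ℚ_[p]) h
  have hΓ := padicGamma_mul_padicGamma_modEq_sq (p := p) (x := x) (y := 2 * x + m) (z := -m)
    (by lia) (by rw [hpm]; linear_combination -m * hx) (by rw [hpm]; linear_combination m * hx)
  have hP := legendreSum_one_two_mul_mul_padicGamma (by lia) hu (show 2 * m < p by lia)
  rw [PadicInt.coe_mul, ← hP] at hΓ
  have hS : PadicModEq p 2 (legendreSum harmonic (2 * m) : ℚ)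
      ((-padicGamma p (2 * x) * padicGamma p x ^ 2 : ℤ_[p]) * (harmonic (2 * m) : ℚ)) := by
    rw [legendreSum_harmonic_two_mul]
    convert hΓ.mul_left (-padicGamma p (2 * x) * padicHarmonic p (2 * m)) using 1 <;>
      push_cast [coe_padicHarmonic (show 2 * m < p by lia)]
    · linear_combination (legendreSum 1 (2 * m) : ℚ_[p]) * (harmonic (2 * m) : ℚ) * hsq
    · ring
  convert hS.trans ((harmonic_modEq_fermatQuotient hp hn).mul_left _) using 1
  push_cast
  ring

theorem legendreSum_harmonic_two_mul_add_one_modEq {m : ℕ} (hm : p = 4 * m + 3)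
    {u x : ℤ_[p]} (hu : 2 * u = 1) (hx : 4 * x = 1) :
    PadicModEq p 2 (legendreSum harmonic (2 * m + 1) : ℚ)
      (1 / 2 * padicGamma p u * padicGamma p x ^ 2) := by
  have hpm : (p : ℤ_[p]) = 4 * m + 3 := by exact_mod_cast congrArg (Nat.cast : ℕ → ℤ_[p]) hm
  obtain rfl : u = 2 * x := by linear_combination 2 * x * hu - u * hx
  have hsq : (padicGamma p (2 * x) : ℚ_[p]) ^ 2 = 1 := by
    have h := padicGamma_sq_of_two_mul_eq_one (show p = 2 * (2 * m + 1) + 1 by lia) hu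
    rw [show 2 * m + 1 + 1 = 2 * (m + 1) by ring, (even_two_mul (m + 1)).neg_one_pow] at h
    exact_mod_cast congrArg ((↑) : ℤ_[p] → ℚ_[p]) h
  have hΓ := padicGamma_mul_padicGamma_modEq_sq (p := p) (x := x) (y := m + 1)
    (z := -(2 * x + m)) (by lia) (by rw [hpm]; linear_combination -(m + 1 : ℤ_[p]) * hx)
    (by rw [hpm]; linear_combination (m : ℤ_[p]) * hx)
  have hS := legendreSum_harmonic_two_mul_add_one_mul_padicGamma (by lia) hu
    (show 2 * m + 1 < p by lia)
  have hhalf := coe_eq_half_of_two_mul_eq_one hu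
  convert hΓ.mul_left (2 * x * padicGamma p (2 * x)) using 1
  · rw [PadicInt.coe_mul, hhalf, PadicInt.coe_mul]
    linear_combination (padicGamma p (2 * x) : ℚ_[p]) * hS -
      (legendreSum harmonic (2 * m + 1) : ℚ_[p]) * hsq
  · rw [PadicInt.coe_mul, hhalf, PadicInt.coe_pow]

end Congruences

theorem mainTheorem4 (p : ℕ) [Fact p.Prime] (hp : 3 < p) :
    (p % 4 = 1 →
      PadicModEq p 2
        ((∑ k ∈ Finset.range p,
          ((2 * k).choose k : ℚ) ^ 2 * (harmonic k / (32 : ℚ) ^ k) : ℚ) : ℚ_[p])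
        ((padicGamma p (PadicInt.inv 2) : ℚ_[p]) * (padicGamma p (PadicInt.inv 4) : ℚ_[p]) ^ 2 *
          ((2 * fermatQuotient p 2 - p * fermatQuotient p 2 ^ 2 : ℚ) : ℚ_[p]))) ∧
    (p % 4 = 3 →
      PadicModEq p 2
        ((∑ k ∈ Finset.range p,
          ((2 * k).choose k : ℚ) ^ 2 * (harmonic k / (32 : ℚ) ^ k) : ℚ) : ℚ_[p])
        (1 / 2 * (padicGamma p (PadicInt.inv 2) : ℚ_[p]) *
          (padicGamma p (PadicInt.inv 4) : ℚ_[p]) ^ 2)) := by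
  obtain ⟨hu, hx⟩ := inv_two_four p hp
  constructor <;> intro hmod
  · obtain ⟨m, hm⟩ : ∃ m, p = 4 * m + 1 := ⟨p / 4, by lia⟩
    exact (sum_centralBinom_sq_mul_harmonic_modEq (show p = 2 * (2 * m) + 1 by lia)).trans
      (legendreSum_harmonic_two_mul_modEq hp hm hu hx)
  · obtain ⟨m, hm⟩ : ∃ m, p = 4 * m + 3 := ⟨p / 4, by lia⟩
    exact (sum_centralBinom_sq_mul_harmonic_modEq (show p = 2 * (2 * m + 1) + 1 by lia)).trans
      (legendreSum_harmonic_two_mul_add_one_modEq hm hu hx)
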